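/- Let $K$ be an oriented (smooth) knot in $S^3$, let $E_K=S^3\setminus\nu(K)$ be its exterior, where $\nu(K)$ is an open tubular neighbourhood of $K$, and let $G(K)=\pi_1(E_K)$. Let $\phi\colon G(K)\to\mathbb Z=\langle t\rangle$ be the abelianization that sends an oriented meridian to $t$. Fix a Wirtinger presentation $G(K)=\langle s_1,\dots,s_n\mid r_1,\dots,r_{n-1}\rangle$. For a representation $\varrho\colon G(K)\to \mathrm{GL}(k,\mathbb Z)$ let $\Phi\colon\mathbb Z[F_n]\to \mathrm{Mat}(k,\mathbb Z[t^{\pm1}])$ be the ring homomorphism induced by $s\mapsto\phi(s)\varrho(s)$. The twisted Alexander polynomial of $K$ associated with $\varrho$ is $$\Delta_K^{\varrho}(t)=\frac{\det M_j}{\det\Phi(s_j-1)}\in\mathbb Q(t),$$ where $M_j$ is obtained from the block matrix $\bigl(\Phi(\partial r_i/\partial s_l)\bigr)_{i,l}$ of free differentials by removing the $j$-th block column; it is well defined up to multiplication by $\pm t^l$ $(l\in\mathbb Z)$. A finite group $G$ with regular representation $\rho\colon G\to\mathrm{GL}(|G|,\mathbb Z)$ is called a twisted Alexander vanishing (TAV)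 group of $K$ if there is an epimorphism $f\colon G(K)\to G$ with $\Delta_K^{\rho\circ f}(t)=0$, and a TAV group if it is a TAV group of some knot. The TAV order $\mathcal O(K)\in\mathbb N\cup\{+\infty\}$ is the least order of a TAV group of $K$ if $K$ is not fibered, and $\mathcal O(K)=+\infty$ if $K$ is fibered. Theorem. For every knot $K$ in $S^3$ we have $\mathcal O(K)\ge 24$. Moreover, no finite group of order less than $24$ is a TAV group. -/

import Mathlib

open scoped Manifold ContDiff

noncomputable section

/-! ### Fox calculus -/

section FoxCalculus

variable {ι : Type*} [DecidableEq ι]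

/-- The Fox derivative with respect to `s j` of the word `w` in the letters `s i` (that is
`(i, true)`) and `(s i)⁻¹` (that is `(i, false)`):
`∂(x w) = ∂ x + x ∂ w`, `∂ (s i) = δ i j` and `∂ (s i)⁻¹ = - δ i j (s i)⁻¹`. -/
def foxWord (j : ι) : List (ι × Bool) → MonoidAlgebra ℤ (FreeGroup ι)
  | [] => 0
  | (i, true) :: w =>
      (if i = j then 1 else 0) + MonoidAlgebra.of ℤ _ (FreeGroup.of i) * foxWord j w
  | (i, false) :: w =>
      (if i = j then -MonoidAlgebra.of ℤ _ (FreeGroup.of i)⁻¹ else 0)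
        + MonoidAlgebra.of ℤ _ (FreeGroup.of i)⁻¹ * foxWord j w

lemma foxWord_append (j : ι) (u v : List (ι × Bool)) :
    foxWord j (u ++ v) =
      foxWord j u + MonoidAlgebra.of ℤ _ (FreeGroup.mk u) * foxWord j v := by
  induction u with
  | nil =>
    have h : (FreeGroup.mk ([] : List (ι × Bool))) = 1 := rfl
    rw [h, map_one, one_mul]
    simp [foxWord]
  | cons a u ih =>
    obtain ⟨i, b⟩ := a
    have h : FreeGroup.mk ((i, b) :: u) = FreeGroup.mk [(i, b)] * FreeGroup.mk u := rfl
    cases b with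
    | true =>
      have h' : FreeGroup.mk [(i, true)] = FreeGroup.of i := rfl
      rw [h, h', map_mul, List.cons_append, foxWord, foxWord, ih, mul_add, add_assoc, mul_assoc]
    | false =>
      have h' : FreeGroup.mk [(i, false)] = (FreeGroup.of i)⁻¹ := rfl
      rw [h, h', map_mul, List.cons_append, foxWord, foxWord, ih, mul_add, add_assoc, mul_assoc]

lemma foxWord_step (j : ι) {u v : List (ι × Bool)} (h : FreeGroup.Red.Step u v) :
    foxWord j u = foxWord j v := by
  obtain ⟨⟩ := h
  rename_i u v i b
  rw [foxWord_append, foxWord_append]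
  congr 2
  cases b
  · simp only [Bool.not_false, foxWord, mul_add, ← mul_assoc, ← map_mul, inv_mul_cancel, map_one,
      one_mul, ← add_assoc]
    split_ifs <;> simp
  · simp only [Bool.not_true, foxWord, mul_add, ← mul_assoc, ← map_mul, mul_inv_cancel, map_one,
      one_mul, ← add_assoc]
    split_ifs
    · rw [mul_neg, ← map_mul, mul_inv_cancel, map_one]; simp
    · simp

/-- The free differential `∂ / ∂ s_j : F → ℤ[F]` on the free group `F` on the letters `s_i`. -/
def foxDeriv (j : ι) (w : FreeGroup ι) : MonoidAlgebra ℤ (FreeGroup ι) :=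
  Quot.lift (foxWord j) (fun _ _ h => foxWord_step j h) w

lemma foxDeriv_of (i j : ι) : foxDeriv j (FreeGroup.of i) = if i = j then 1 else 0 := by
  change foxWord j [(i, true)] = _
  simp [foxWord]

lemma foxDeriv_mul (j : ι) (u v : FreeGroup ι) :
    foxDeriv j (u * v) = foxDeriv j u + MonoidAlgebra.of ℤ _ u * foxDeriv j v := by
  induction u using Quot.ind
  induction v using Quot.ind
  exact foxWord_append j _ _

end FoxCalculus

/-! ### Wirtinger presentations and twisted Alexander polynomials

In this section `Γ` is a group with a distinguished element `μ`; below it is applied to the group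
of an oriented knot and an oriented meridian. -/

section TwistedAlexander

/-- A Wirtinger presentation `⟨s_0, …, s_m ∣ r_0, …, r_{m-1}⟩` of `Γ`: every generator is
(conjugate to) the meridian `μ`, and every relator is the relator
`s_i^{±1} s_j s_i^{∓1} s_k⁻¹` of a crossing at which the arc `i` passes over and the arcs
`j`, `k` pass under. -/
structure WirtingerPresentation (Γ : Type*) [Group Γ] (μ : Γ) where
  /-- the number of relators; there is one generator more -/
  m : ℕ
  /-- the relators -/
  rel : Fin m → FreeGroup (Fin (m + 1))
  /-- the images of the generators in `Γ` -/
  gen : Fin (m + 1) → Γ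
  rel_crossing : ∀ a, ∃ i j k : Fin (m + 1),
    rel a = FreeGroup.of i * FreeGroup.of j * (FreeGroup.of i)⁻¹ * (FreeGroup.of k)⁻¹ ∨
    rel a = (FreeGroup.of i)⁻¹ * FreeGroup.of j * FreeGroup.of i * (FreeGroup.of k)⁻¹
  gen_meridian : ∀ i, IsConj μ (gen i)
  surjective : Function.Surjective (FreeGroup.lift gen)
  ker_eq : (FreeGroup.lift gen).ker = Subgroup.normalClosure (Set.range rel)

variable {Γ : Type*} [Group Γ] {μ : Γ} {R : Type*} [CommRing R]
  {κ : Type*} [Fintype κ] [DecidableEq κ]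

/-- The homomorphism `φ ⊗ ϱ : Γ → Mat(k, R[t^{±1}])`, `s ↦ t^{φ(s)} ϱ(s)`. -/
def tensorHom (φ : Γ →* Multiplicative ℤ) (ϱ : Γ →* GL κ R) :
    Γ →* Matrix κ κ (LaurentPolynomial R) where
  toFun s := LaurentPolynomial.T (R := R) (Multiplicative.toAdd (φ s)) •
    (ϱ s : Matrix κ κ R).map LaurentPolynomial.C
  map_one' := by
    simp [LaurentPolynomial.T_zero]
  map_mul' s s' := by
    simp only [map_mul, toAdd_mul, LaurentPolynomial.T_add, Units.val_mul, Matrix.map_mul,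
      Matrix.smul_mul, Matrix.mul_smul, smul_smul]
    rw [mul_comm]

namespace WirtingerPresentation

/-- The ring homomorphism `Φ : ℤ[F] → ℤ[Γ] → Mat(k, R[t^{±1}])`. -/
def Phi (P : WirtingerPresentation Γ μ) (φ : Γ →* Multiplicative ℤ) (ϱ : Γ →* GL κ R) :
    MonoidAlgebra ℤ (FreeGroup (Fin (P.m + 1))) →ₐ[ℤ] Matrix κ κ (LaurentPolynomial R) :=
  MonoidAlgebra.lift ℤ _ _ ((tensorHom φ ϱ).comp (FreeGroup.lift P.gen))

/-- The matrix `M_j`: the block matrix `(Φ (∂ r_a / ∂ s_b))` without its `j`-th block column. -/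
def foxMatrix (P : WirtingerPresentation Γ μ) (φ : Γ →* Multiplicative ℤ) (ϱ : Γ →* GL κ R)
    (j : Fin (P.m + 1)) : Matrix (Fin P.m × κ) (Fin P.m × κ) (LaurentPolynomial R) :=
  Matrix.of fun a b => P.Phi φ ϱ (foxDeriv (j.succAbove b.1) (P.rel a.1)) a.2 b.2

/-- Wada's rational expression `det M_j / det Φ(s_j - 1)` in `Q(t)`, the field of fractions
of `R[t^{±1}]`. -/
def wada [IsDomain R] (P : WirtingerPresentation Γ μ) (φ : Γ →* Multiplicative ℤ)
    (ϱ : Γ →* GL κ R) (j : Fin (P.m + 1)) : FractionRing (LaurentPolynomial R) :=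
  algebraMap _ _ (P.foxMatrix φ ϱ j).det /
    algebraMap _ _ (P.Phi φ ϱ (MonoidAlgebra.of ℤ _ (FreeGroup.of j) - 1)).det

end WirtingerPresentation

/-- `Δ` is the twisted Alexander polynomial of `(Γ, μ)` associated with `ϱ`, which is defined up to
multiplication by `ε t^l` with `ε ∈ Rˣ` and `l ∈ ℤ`: the map `φ` is the abelianization
`Γ → ℤ = ⟨t⟩` with `φ(μ) = t`. -/
def IsTwistedAlexanderPolynomial [IsDomain R] (μ : Γ) (ϱ : Γ →* GL κ R)
    (Δ : FractionRing (LaurentPolynomial R)) : Prop :=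
  ∃ (φ : Γ →* Multiplicative ℤ) (P : WirtingerPresentation Γ μ) (j : Fin (P.m + 1))
    (ε : Rˣ) (l : ℤ),
    φ.ker = commutator Γ ∧ φ μ = Multiplicative.ofAdd 1 ∧
    Δ = algebraMap (LaurentPolynomial R) _
      (LaurentPolynomial.C (ε : R) * LaurentPolynomial.T l) * P.wada φ ϱ j

end TwistedAlexander

/-- The regular representation `G → GL(|G|, ℤ)`, the permutation representation of the right
multiplication: the basis (row) vector `x` is sent by `g` to the basis vector `x * g`. -/
def regularRep (G : Type*) [Group G] [Fintype G] [DecidableEq G] : G →* GL G ℤ :=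
  MonoidHom.toHomUnits
    { toFun := fun g => Matrix.of fun x y => if x * g = y then (1 : ℤ) else 0
      map_one' := by
        ext x y
        simp [Matrix.one_apply]
      map_mul' := fun g h => by
        ext x y
        simp only [Matrix.of_apply, Matrix.mul_apply, ite_mul, one_mul, zero_mul,
          Finset.sum_ite_eq, Finset.mem_univ, if_true, mul_assoc] }

/-! ### Knots in the 3-sphere -/

/-- The unit sphere `S³` of `ℝ⁴`. -/
abbrev S3 : Type := Metric.sphere (0 : EuclideanSpace ℝ (Fin 4)) 1

instance : Fact (Module.finrank ℝ (EuclideanSpace ℝ (Fin 4)) = 3 + 1) :=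
  ⟨by simp⟩

/-- An oriented (smooth) knot in `S³`: a smooth embedding of the (counterclockwise oriented)
circle. -/
structure OrientedKnot where
  /-- the embedding -/
  toFun : Circle → S3
  smoothEmbedding : Manifold.IsSmoothEmbedding (𝓡 1) (𝓡 3) ∞ toFun

namespace OrientedKnot

/-- An orientation preserving parametrization by `S¹ × ℂ` of a neighbourhood of the knot, with
`S¹ × {0}` parametrizing the knot. The open tubular neighbourhood proper is the image of the open
solid torus `S¹ × {|w| < 1}`. The sphere `S³` is oriented as the boundary of the unit ball: a basis
`v₁, v₂, v₃` of the tangent space at `x` is positive if `det(x, v₁, v₂, v₃) > 0`. -/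
structure Tube (K : OrientedKnot) where
  /-- the parametrization -/
  toFun : Circle × ℂ → S3
  smoothEmbedding : Manifold.IsSmoothEmbedding ((𝓡 1).prod 𝓘(ℝ, ℂ)) (𝓡 3) ∞ toFun
  core : ∀ z, toFun (z, 0) = K.toFun z
  orientation : ∀ (s : ℝ) (w : ℂ),
    let T : ℝ × ℂ → EuclideanSpace ℝ (Fin 4) := fun p => (toFun (Circle.exp p.1, p.2)).1
    0 < (Matrix.of ![(T (s, w)).ofLp, (fderiv ℝ T (s, w) (1, 0)).ofLp,
      (fderiv ℝ T (s, w) (0, 1)).ofLp, (fderiv ℝ T (s, w) (0, Complex.I)).ofLp]).det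

namespace Tube

variable {K : OrientedKnot} (N : K.Tube)

/-- The open tubular neighbourhood `ν(K)`. -/
def nu : Set S3 := N.toFun '' {p | ‖p.2‖ < 1}

/-- The exterior `E_K = S³ \ ν(K)`. -/
abbrev Exterior : Type := {x : S3 // x ∉ N.nu}

lemma boundary_notMem (z w : Circle) : N.toFun (z, (w : ℂ)) ∉ N.nu := by
  rintro ⟨p, hp, h⟩
  have h' := N.smoothEmbedding.isEmbedding.injective h
  subst h'
  simp [Circle.norm_coe] at hp

/-- The base point, on the boundary torus. -/
def base : N.Exterior := ⟨N.toFun (1, ((1 : Circle) : ℂ)), N.boundary_notMem 1 1⟩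

/-- The boundary of a fibre of the tubular neighbourhood, run through once counterclockwise. -/
def meridianPath : Path N.base N.base where
  toFun s := ⟨N.toFun (1, (Circle.exp (2 * Real.pi * s) : ℂ)), N.boundary_notMem _ _⟩
  continuous_toFun := by
    have h := N.smoothEmbedding.isEmbedding.continuous
    exact Continuous.subtype_mk (by fun_prop) _
  source' := by simp [base]
  target' := by simp [base]

/-- The knot group `G(K) = π₁(E_K)`. The product of Mathlib's fundamental group composes loops
from right to left, so that the usual group (first the left factor, then the right one) is its
opposite. -/
abbrev knotGroup : Type := (FundamentalGroup N.Exterior N.base)ᵐᵒᵖ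

/-- The oriented meridian `μ_K`. -/
def meridian : N.knotGroup :=
  MulOpposite.op (FundamentalGroup.fromPath (Path.Homotopic.Quotient.mk N.meridianPath))

end Tube

open Classical in
/-- The finite group `G` is a twisted Alexander vanishing group of the knot `K`: for some
epimorphism `f : G(K) → G` the twisted Alexander polynomial associated with `ρ ∘ f` is zero, where
`ρ` is the regular representation of `G`. -/
def IsTAVGroup (K : OrientedKnot) (G : Type*) [Group G] [Finite G] : Prop :=
  letI := Fintype.ofFinite G
  ∃ (N : K.Tube) (f : N.knotGroup →* G), Function.Surjective f ∧
    IsTwistedAlexanderPolynomial N.meridian ((regularRep G).comp f) 0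

/-- The knot `K` is fibered: its complement is a locally trivial bundle over the circle, which
near the knot is the map `(z, w) ↦ w / |w|` (so that the closures of the fibres are Seifert
surfaces of `K`). -/
def IsFibered (K : OrientedKnot) : Prop :=
  ∃ (N : K.Tube) (p : {x : S3 // x ∉ Set.range K.toFun} → Circle)
    (F : Type) (_ : TopologicalSpace F),
    (∀ b : Circle, ∃ e : Bundle.Trivialization F p, b ∈ e.baseSet) ∧
    ∀ x (z : Circle) (w : ℂ), w ≠ 0 → x.1 = N.toFun (z, w) → (p x : ℂ) = w / ‖w‖

open Classical in
/-- The TAV order `𝒪(K)`: `+∞` if `K` is fibered, and the least order of a TAV group of `K`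
otherwise. -/
def tavOrder (K : OrientedKnot) : ℕ∞ :=
  if K.IsFibered then ⊤ else
    sInf {n : ℕ∞ | ∃ (G : Type) (_ : Group G) (_ : Finite G), K.IsTAVGroup G ∧ n = Nat.card G}

end OrientedKnot

/-- The finite group `G` is a TAV group, that is, a TAV group of some knot. -/
def IsTAVGroup (G : Type*) [Group G] [Finite G] : Prop :=
  ∃ K : OrientedKnot, K.IsTAVGroup G

end

/-! The Fox determinant is nonzero exactly when no nonzero crossed homomorphism on the free group
vanishes on the relators and on the letter `j` (`det_foxBlockMatrix_ne_zero_iff`). This property,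
`FoxRigid`, passes to extensions of modules, so it can be checked on one-dimensional pieces.

Suppose the commutator subgroup G' of the finite quotient G is a p-group, and reduce modulo p. In
characteristic p, G' has nonzero fixed vectors; they form a G-stable space, in which the image of a
meridian has an eigenvector. All meridians have the same image modulo G', so this eigenvector spans
a G-stable line on which every letter acts by one scalar a. Peeling off such lines filters the whole
representation. After twisting by t, the determinant on a line is the untwisted one evaluated at ta.
The untwisted determinant is nonzero at t = 1 modulo p, because a homomorphism to 𝔽_p killing one
meridian kills all of them (`foxRigid_trivial`). So it is a nonzero Laurent polynomial, and ta is
transcendental since a is a root of unity. Hence the integral determinant is nonzero already modulo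
p (`det_foxMatrix_ne_zero_of_isPGroup_commutator`).

It remains to see that G' is a p-group when |G| < 24 (`exists_isPGroup_commutator`). The
abelianization of G is cyclic, G is not perfect unless trivial, so |G'| < 12 for nontrivial G. The
orders 6 and 10 are excluded because a G-normal subgroup of index 2 in G' would give a nonabelian
quotient of G that is central-by-cyclic. -/

noncomputable section

/-! ### Fox determinants and crossed homomorphisms. -/

section FoxRigidity

variable {ι : Type*}

/-- Every Fox cocycle (crossed homomorphism on the free group for the action `act`) which vanishes
on the words `r a` and on the letter `j` is zero. -/
def FoxRigid {α V : Type*} [AddCommGroup V] (r : α → FreeGroup ι) (j : ι)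
    (act : FreeGroup ι → V → V) : Prop :=
  ∀ d : FreeGroup ι → V, (∀ u v, d (u * v) = d u + act u (d v)) → (∀ a, d (r a) = 0) →
    d (FreeGroup.of j) = 0 → ∀ w, d w = 0

/-- A cocycle is determined by its values on the letters. -/
lemma cocycle_eq_zero_of_letters {V : Type*} [AddCommGroup V] (act : FreeGroup ι → V →+ V)
    (hact : act 1 = AddMonoidHom.id V) (d : FreeGroup ι → V)
    (hd : ∀ u v, d (u * v) = d u + act u (d v))
    (h : ∀ i, d (FreeGroup.of i) = 0) (w : FreeGroup ι) : d w = 0 := by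
  have h1 : d 1 = 0 := by simpa [hact] using hd 1 1
  induction w with
  | C1 => exact h1
  | of i => exact h i
  | inv_of i hi =>
    have h2 := hd (FreeGroup.of i)⁻¹ (FreeGroup.of i)
    rw [inv_mul_cancel, h1, h i, map_zero, add_zero] at h2
    exact h2.symm
  | mul u v hu hv => rw [hd, hu, hv, map_zero, add_zero]

/-- The block matrix of the free differentials of the words `r a` for the letters `b ≠ j`. -/
def foxBlockMatrix {m : ℕ} {κ S : Type*} [Fintype κ] [DecidableEq κ] [CommRing S]
    (r : Fin m → FreeGroup (Fin (m + 1))) (j : Fin (m + 1))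
    (A : FreeGroup (Fin (m + 1)) →* Matrix κ κ S) : Matrix (Fin m × κ) (Fin m × κ) S :=
  Matrix.of fun a b =>
    MonoidAlgebra.lift ℤ _ _ A (foxDeriv (j.succAbove b.1) (r a.1)) a.2 b.2

variable {m : ℕ} {κ S S' : Type*} [Fintype κ] [DecidableEq κ] [CommRing S] [CommRing S']
  (r : Fin m → FreeGroup (Fin (m + 1))) (j : Fin (m + 1))
  (A : FreeGroup (Fin (m + 1)) →* Matrix κ κ S)

lemma foxBlockMatrix_map (h : S →+* S') :
    (foxBlockMatrix r j A).map h =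
      foxBlockMatrix r j ((h.mapMatrix : Matrix κ κ S →+* Matrix κ κ S').toMonoidHom.comp A) := by
  have key : ∀ x, (MonoidAlgebra.lift ℤ _ _ A x).map h = MonoidAlgebra.lift ℤ _ _
      ((h.mapMatrix : Matrix κ κ S →+* Matrix κ κ S').toMonoidHom.comp A) x := by
    intro x
    induction x using MonoidAlgebra.induction_linear with
    | zero => ext; simp
    | add x y hx hy => rw [map_add, map_add, ← hx, ← hy]; ext; simp
    | single w n =>
      rw [MonoidAlgebra.lift_single, MonoidAlgebra.lift_single]
      ext
      exact map_zsmul h n _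
  ext a b
  exact congrFun (congrFun (key _) a.2) b.2

lemma det_foxBlockMatrix_map (h : S →+* S') :
    h (foxBlockMatrix r j A).det =
      (foxBlockMatrix r j
        ((h.mapMatrix : Matrix κ κ S →+* Matrix κ κ S').toMonoidHom.comp A)).det := by
  rw [← foxBlockMatrix_map, RingHom.map_det]
  rfl

/-- The cocycle with prescribed values `v` on the letters other than `j`, and `0` on `j`. -/
def foxCocycle (v : Fin m × κ → S) (w : FreeGroup (Fin (m + 1))) : κ → S :=
  ∑ b : Fin m, (MonoidAlgebra.lift ℤ _ _ A (foxDeriv (j.succAbove b) w)).mulVec fun x => v (b, x)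

lemma foxCocycle_mul (v : Fin m × κ → S) (u w : FreeGroup (Fin (m + 1))) :
    foxCocycle j A v (u * w) = foxCocycle j A v u + (A u).mulVec (foxCocycle j A v w) := by
  simp only [foxCocycle, foxDeriv_mul, map_add, map_mul, Matrix.add_mulVec,
    Finset.sum_add_distrib, Matrix.mulVec_sum, Matrix.mulVec_mulVec]
  simp

lemma foxCocycle_of_self (v : Fin m × κ → S) : foxCocycle j A v (FreeGroup.of j) = 0 := by
  refine Finset.sum_eq_zero fun b _ => ?_
  rw [foxDeriv_of, if_neg (Fin.succAbove_ne j b).symm, map_zero, Matrix.zero_mulVec]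

lemma foxCocycle_of_succAbove (v : Fin m × κ → S) (b : Fin m) :
    foxCocycle j A v (FreeGroup.of (j.succAbove b)) = fun x => v (b, x) := by
  rw [foxCocycle, Finset.sum_eq_single b]
  · rw [foxDeriv_of, if_pos rfl, map_one, Matrix.one_mulVec]
  · intro c _ hc
    rw [foxDeriv_of, if_neg fun h => hc (Fin.succAbove_right_injective h).symm, map_zero,
      Matrix.zero_mulVec]
  · simp

lemma foxBlockMatrix_mulVec (v : Fin m × κ → S) (a : Fin m) (x : κ) :
    (foxBlockMatrix r j A).mulVec v (a, x) = foxCocycle j A v (r a) x := by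
  simp only [Matrix.mulVec, dotProduct, foxBlockMatrix, Matrix.of_apply, foxCocycle,
    Finset.sum_apply, Fintype.sum_prod_type]

/-- A kernel vector lists the values, on the letters other than `j`, of a crossed homomorphism
vanishing on `j`; the rows of the matrix evaluate it on the relators. -/
lemma det_foxBlockMatrix_ne_zero_iff [IsDomain S] :
    (foxBlockMatrix r j A).det ≠ 0 ↔ FoxRigid r j fun w v => (A w).mulVec v := by
  have hA : ∀ w, ∃ f : (κ → S) →+ (κ → S), ∀ v, f v = (A w).mulVec v := fun w =>
    ⟨(Matrix.mulVecLin (A w)).toAddMonoidHom, fun v => rfl⟩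
  choose f hf using hA
  have hf1 : f 1 = AddMonoidHom.id _ := by
    refine AddMonoidHom.ext fun v => ?_
    rw [hf, map_one, Matrix.one_mulVec]
    rfl
  constructor
  · intro hdet d hd hr hj
    set v : Fin m × κ → S := fun b => d (FreeGroup.of (j.succAbove b.1)) b.2
    have hdv : ∀ w, d w = foxCocycle j A v w := by
      intro w
      rw [← sub_eq_zero]
      refine cocycle_eq_zero_of_letters f hf1 (fun w => d w - foxCocycle j A v w) ?_ ?_ w
      · intro u w
        simp only [hd, foxCocycle_mul, hf, Matrix.mulVec_sub]
        abel
      · intro i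
        rcases Fin.eq_self_or_eq_succAbove j i with rfl | ⟨b, rfl⟩
        · simp only [hj, foxCocycle_of_self, sub_zero]
        · simp only [foxCocycle_of_succAbove, v]
          exact sub_self _
    have hv : v = 0 := by
      by_contra hv
      refine hdet (Matrix.exists_mulVec_eq_zero_iff.1 ⟨v, hv, ?_⟩)
      ext ⟨a, x⟩
      rw [foxBlockMatrix_mulVec, ← hdv, hr]
      rfl
    intro w
    rw [hdv, hv, foxCocycle]
    exact Finset.sum_eq_zero fun b _ => Matrix.mulVec_zero _
  · intro h hdet
    obtain ⟨v, hv, hv'⟩ := Matrix.exists_mulVec_eq_zero_iff.2 hdet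
    apply hv
    have h0 := h (foxCocycle j A v) (foxCocycle_mul j A v)
      (fun a => by ext x; rw [← foxBlockMatrix_mulVec, hv']; rfl) (foxCocycle_of_self j A v)
    ext ⟨b, x⟩
    have h1 := h0 (FreeGroup.of (j.succAbove b))
    rw [foxCocycle_of_succAbove] at h1
    exact congrFun h1 x

lemma FoxRigid.of_injective {ι α V W : Type*} [AddCommGroup V] [AddCommGroup W]
    {r : α → FreeGroup ι} {j : ι} {act : FreeGroup ι → V → V} {act' : FreeGroup ι → W → W}
    (h : FoxRigid r j act') (f : V →+ W) (hf : Function.Injective f)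
    (hact : ∀ w v, f (act w v) = act' w (f v)) : FoxRigid r j act := fun d hd hr hj w =>
  hf <| (h (fun u => f (d u)) (fun u v => by simp only [hd, map_add, hact])
    (fun a => by simp only [hr, map_zero]) (by simp only [hj, map_zero]) w).trans (map_zero f).symm

/-- The scalar `1 × 1` matrix representation by `c` on every letter. -/
def letterScalar (ι : Type*) {S : Type*} [CommRing S] (c : Sˣ) :
    FreeGroup ι →* Matrix Unit Unit S :=
  (Matrix.scalar Unit : S →+* Matrix Unit Unit S).toMonoidHom.comp
    ((Units.coeHom S).comp (FreeGroup.lift fun _ => c))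

lemma foxRigid_letterScalar_iff (c : Sˣ) :
    (FoxRigid r j fun w v => (letterScalar _ c w).mulVec v) ↔
      FoxRigid r j fun w (v : S) => (FreeGroup.lift (fun _ => c) w : S) * v := by
  constructor
  · intro h
    refine h.of_injective
      (AddMonoidHom.mk' (fun v (_ : Unit) => v) fun _ _ => rfl) (fun u v huv => congrFun huv ()) ?_
    intro w v
    ext
    simp [letterScalar]
  · intro h
    refine h.of_injective
      (AddMonoidHom.mk' (fun v : Unit → S => v ()) fun _ _ => rfl)
        (fun u v huv => funext fun _ => huv) ?_
    intro w v
    simp [letterScalar]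

lemma det_letterScalar_map (h : S →+* S') (c : Sˣ) (c' : S'ˣ) (hc : h c = c') :
    h (foxBlockMatrix r j (letterScalar _ c)).det =
      (foxBlockMatrix r j (letterScalar _ c')).det := by
  rw [det_foxBlockMatrix_map]
  congr 2
  ext i
  simp [letterScalar, hc]

/-- If the trivial module `F` is rigid, so is every module on which all letters act by an element
`c` which is transcendental over `F`. -/
lemma FoxRigid.of_transcendental {F k : Type*} [Field F] [Field k] [Algebra F k]
    (hr : FoxRigid r j fun _ (v : F) => v) (c : kˣ) (hc : Transcendental F (c : k)) :
    FoxRigid r j fun w (v : k) => (FreeGroup.lift (fun _ => c) w : k) * v := by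
  rw [← foxRigid_letterScalar_iff, ← det_foxBlockMatrix_ne_zero_iff]
  have h1 : (foxBlockMatrix r j (letterScalar _ (1 : Fˣ))).det ≠ 0 := by
    rw [det_foxBlockMatrix_ne_zero_iff, foxRigid_letterScalar_iff]
    have : (FreeGroup.lift fun _ : Fin (m + 1) => (1 : Fˣ)) = 1 := by
      ext
      simp
    simpa [this] using hr
  set t : (LaurentPolynomial F)ˣ := (LaurentPolynomial.isUnit_T 1).unit
  have ht : (t : LaurentPolynomial F) = LaurentPolynomial.T 1 := rfl
  set D := (foxBlockMatrix r j (letterScalar _ t)).det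
  -- Setting t = 1 recovers the determinant of the trivial module, nonzero by `h1`.
  have hD : D ≠ 0 := by
    intro h
    refine h1 ?_
    rw [← det_letterScalar_map r j (LaurentPolynomial.eval₂ (RingHom.id F) 1) t 1
      (by rw [ht, LaurentPolynomial.eval₂_T, zpow_one])]
    exact (congrArg _ h).trans (map_zero _)
  rw [← det_letterScalar_map r j (LaurentPolynomial.eval₂ (algebraMap F k) c) t c
      (by rw [ht, LaurentPolynomial.eval₂_T, zpow_one])]
  -- Clearing negative powers of t turns a zero of `D` at `c` into a polynomial relation for `c`
  -- over `F`.
  obtain ⟨n, f, hf⟩ := D.exists_T_pow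
  intro h0
  have h2 : Polynomial.aeval (c : k) f = 0 := by
    rw [Polynomial.aeval_def, ← LaurentPolynomial.eval₂_toLaurent, hf, map_mul]
    exact mul_eq_zero_of_left h0 _
  have h3 : f = 0 := transcendental_iff.1 hc f h2
  rw [h3, map_zero, eq_comm] at hf
  exact hD ((LaurentPolynomial.isUnit_T (R := F) n).mul_left_eq_zero.1 hf)

/-- Rigidity passes to extensions of modules. -/
lemma FoxRigid.of_quotient {ι α k V : Type*} [Ring k] [AddCommGroup V] [Module k V]
    {r : α → FreeGroup ι} {j : ι} {act : FreeGroup ι → V → V} (L : Submodule k V)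
    {actL : FreeGroup ι → L → L} {actQ : FreeGroup ι → (V ⧸ L) → (V ⧸ L)}
    (hL : FoxRigid r j actL) (hQ : FoxRigid r j actQ) (hactL : ∀ w v, (actL w v : V) = act w v)
    (hactQ : ∀ w v, actQ w (L.mkQ v) = L.mkQ (act w v)) : FoxRigid r j act := by
  intro d hd hr hj w
  -- Rigidity of the quotient forces the cocycle into `L`, where rigidity of `L` finishes.
  have h1 : ∀ w, d w ∈ L := fun w => by
    have := hQ (fun w => L.mkQ (d w)) (fun u v => by rw [hd, map_add, hactQ])
      (fun a => by rw [hr, map_zero]) (by rw [hj, map_zero]) w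
    simpa using this
  have h2 := hL (fun w => ⟨d w, h1 w⟩) (fun u v => Subtype.ext (by simp [hd, hactL]))
    (fun a => Subtype.ext (hr a)) (Subtype.ext hj) w
  exact congrArg Subtype.val h2

end FoxRigidity

/-! ### Invariant lines in characteristic p. -/

section PGroupRepresentations

/-- A `p`-group acting linearly in characteristic `p` fixes a nonzero vector. -/
lemma exists_ne_zero_fixed_of_isPGroup {p : ℕ} [Fact p.Prime] {H k V : Type*} [Group H] [Finite H]
    (hH : IsPGroup p H) [CommRing k] [Algebra (ZMod p) k] [AddCommGroup V] [Module k V]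
    [Nontrivial V] (ρ : Representation k H V) : ∃ v : V, v ≠ 0 ∧ ∀ h, ρ h v = v := by
  let _ : Module (ZMod p) V := Module.compHom V (algebraMap (ZMod p) k)
  have hp : ∀ v : V, p • v = 0 := fun v => by
    rw [← Nat.cast_smul_eq_nsmul (ZMod p), CharP.cast_eq_zero, zero_smul]
  obtain ⟨v₀, hv₀⟩ := exists_ne (0 : V)
  -- The field may be infinite, so orbits are counted in the finite 𝔽_p-span of one orbit; 0 is one
  -- fixed point, and p divides the order, so there is another.
  let U : Submodule (ZMod p) V := Submodule.span (ZMod p) (Set.range fun h => ρ h v₀)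
  have hU : ∀ h : H, ∀ u ∈ U, ρ h u ∈ U := by
    intro h
    change U ≤ U.comap ((ρ h).toAddMonoidHom.toZModLinearMap p)
    refine Submodule.span_le.2 ?_
    rintro _ ⟨h', rfl⟩
    refine Submodule.subset_span ⟨h * h', ?_⟩
    simp
  let _ : MulAction H U :=
    { smul := fun h u => ⟨ρ h u, hU h u u.2⟩
      one_smul := fun u => Subtype.ext (by
        change ρ 1 (u : V) = u
        simp)
      mul_smul := fun h h' u => Subtype.ext (by
        change ρ (h * h') (u : V) = ρ h (ρ h' u)
        simp) }
  have hsmul : ∀ (h : H) (u : U), ((h • u : U) : V) = ρ h u := fun _ _ => rfl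
  have : Module.Finite (ZMod p) U :=
    Module.Finite.iff_fg.2 (Submodule.fg_span (Set.finite_range _))
  have : Finite U := Module.finite_of_finite (ZMod p)
  have hv₀U : v₀ ∈ U := Submodule.subset_span ⟨1, by simp⟩
  have hcard : p ∣ Nat.card U := by
    have h1 : addOrderOf (⟨v₀, hv₀U⟩ : U) = p :=
      addOrderOf_eq_prime (Subtype.ext (hp v₀)) fun h => hv₀ (congrArg Subtype.val h)
    exact h1.symm.dvd.trans (addOrderOf_dvd_natCard _)
  obtain ⟨u, hu, hu0⟩ := hH.exists_fixed_point_of_prime_dvd_card_of_fixed_point U hcard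
    (a := 0) fun h => Subtype.ext (by rw [hsmul]; exact map_zero _)
  exact ⟨u, fun h => hu0 (Subtype.ext h.symm), fun h => by rw [← hsmul, hu h]⟩

/-- If the commutator subgroup is a `p`-group, then in characteristic `p` it fixes an eigenvector
of any given element. -/
lemma exists_eigenvector_of_isPGroup_commutator {p : ℕ} [Fact p.Prime] {G k V : Type*} [Group G]
    [Finite G] (hG : IsPGroup p (commutator G)) [Field k] [IsAlgClosed k] [Algebra (ZMod p) k]
    [AddCommGroup V] [Module k V] [FiniteDimensional k V] [Nontrivial V]
    (ρ : Representation k G V) (g : G) :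
    ∃ v : V, v ≠ 0 ∧ (∀ h ∈ commutator G, ρ h v = v) ∧ ∃ a : k, ρ g v = a • v := by
  let W : Submodule k V :=
    { carrier := {v | ∀ h ∈ commutator G, ρ h v = v}
      add_mem' := fun ha hb h hh => by rw [map_add, ha h hh, hb h hh]
      zero_mem' := fun h _ => map_zero _
      smul_mem' := fun c v hv h hh => by rw [map_smul, hv h hh] }
  obtain ⟨v₀, hv₀, hfix⟩ :=
    exists_ne_zero_fixed_of_isPGroup hG (ρ.comp (commutator G).subtype)
  have : Nontrivial W :=
    ⟨⟨v₀, fun h hh => hfix ⟨h, hh⟩⟩, 0, fun h => hv₀ (congrArg Subtype.val h)⟩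
  have hW : ∀ v ∈ W, ρ g v ∈ W := by
    intro v hv h hh
    have h1 := hv (g⁻¹ * h * g) (by
      simpa using (inferInstance : (commutator G).Normal).conj_mem h hh g⁻¹)
    have h2 : h * g = g * (g⁻¹ * h * g) := by group
    rw [← Module.End.mul_apply, ← map_mul, h2, map_mul, Module.End.mul_apply, h1]
  obtain ⟨a, ha⟩ := Module.End.exists_eigenvalue ((ρ g).restrict hW)
  obtain ⟨v, hv⟩ := ha.exists_hasEigenvector
  exact ⟨v, fun h => hv.2 (Subtype.ext h), v.2, a, congrArg Subtype.val hv.apply_eq_smul⟩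

/-- Let `q` map the free group onto `G`, the letters going to conjugates of one another, and suppose
that the commutator subgroup of `G` is a `p`-group. If the trivial module `𝔽_p` is rigid, then so is
every representation of `G` in characteristic `p`, twisted by a transcendental element. -/
lemma FoxRigid.of_isPGroup_commutator {p : ℕ} [Fact p.Prime] {m : ℕ}
    {r : Fin m → FreeGroup (Fin (m + 1))} {j : Fin (m + 1)}
    (hr : FoxRigid r j fun _ (v : ZMod p) => v) {G : Type*} [Group G]
    [Finite G] (hG : IsPGroup p (commutator G)) (q : FreeGroup (Fin (m + 1)) →* G)
    (hq : Function.Surjective q) (hconj : ∀ i, IsConj (q (.of j)) (q (.of i)))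
    {k : Type*} [Field k] [IsAlgClosed k] [Algebra (ZMod p) k] (τ : kˣ)
    (hτ : Transcendental (ZMod p) (τ : k)) {V : Type*} [AddCommGroup V] [Module k V]
    [FiniteDimensional k V] (ρ : Representation k G V) :
    FoxRigid r j fun w v => (FreeGroup.lift (fun _ => τ) w : k) • ρ (q w) v := by
  induction hd : Module.finrank k V using Nat.strong_induction_on generalizing V with
  | _ n ih =>
  cases subsingleton_or_nontrivial V with
  | inl h => exact fun d _ _ _ w => Subsingleton.elim _ _
  | inr h =>
  obtain ⟨v, hv, hfix, a, ha⟩ := exists_eigenvector_of_isPGroup_commutator hG ρ (q (.of j))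
  have ha0 : a ≠ 0 := by
    rintro rfl
    refine hv ?_
    have := congrArg (ρ (q (.of j))⁻¹) ha
    simpa using this
  set α : kˣ := Units.mk0 a ha0
  have hρv : ∀ w, ρ (q w) v = (FreeGroup.lift (fun _ => α) w : k) • v := by
    intro w
    induction w with
    | C1 => simp
    | of i =>
      obtain ⟨c, hc⟩ := isConj_iff.1 (hconj i)
      -- Each letter is a commutator times the letter `j`, and commutators fix `v`.
      have h1 : q (.of i) = c * q (.of j) * c⁻¹ * (q (.of j))⁻¹ * q (.of j) := by
        rw [← hc, inv_mul_cancel_right]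
      rw [h1, map_mul, Module.End.mul_apply, ha, map_smul, hfix]
      · simp [α]
      · exact Subgroup.commutator_mem_commutator (Subgroup.mem_top _) (Subgroup.mem_top _)
    | inv_of i hi =>
      have h1 := congrArg (ρ (q (.of i))⁻¹) hi
      simp only [← Module.End.mul_apply, ← map_mul, inv_mul_cancel, map_one, map_smul,
        Module.End.one_apply] at h1
      rw [map_inv q, map_inv (FreeGroup.lift fun _ => α), Units.val_inv_eq_inv_val, eq_inv_smul_iff₀ (Units.ne_zero _)]
      exact h1.symm
    | mul x y hx hy =>
      rw [map_mul, map_mul, Module.End.mul_apply, hy, map_smul, hx, map_mul, Units.val_mul,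
        smul_smul, mul_comm]
  let L : Submodule k V := k ∙ v
  have hL : ∀ g, L ≤ L.comap (ρ g) := by
    intro g
    obtain ⟨w, rfl⟩ := hq g
    rw [Submodule.span_singleton_le_iff_mem, Submodule.mem_comap, hρv]
    exact Submodule.smul_mem _ _ (Submodule.mem_span_singleton_self v)
  have hLact : ∀ w (u : L), ρ (q w) (u : V) = (FreeGroup.lift (fun _ => α) w : k) • (u : V) := by
    intro w u
    obtain ⟨b, hb⟩ := Submodule.mem_span_singleton.1 u.2
    rw [← hb, map_smul, hρv, smul_comm]
  -- The eigenvalue satisfies α^|G| = 1, so τα and τ have the same |G|-th power.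
  have htrans : Transcendental (ZMod p) ((τ * α : kˣ) : k) := by
    intro h
    have h1 : ((τ * α : kˣ) : k) ^ Nat.card G = (τ : k) ^ Nat.card G := by
      have h2 : a ^ Nat.card G = 1 := by
        have h3 := hρv (.of j ^ Nat.card G)
        rw [map_pow, pow_card_eq_one', map_one, Module.End.one_apply] at h3
        have h4 : ((1 : k) - a ^ Nat.card G) • v = 0 := by
          rw [sub_smul, one_smul, sub_eq_zero]
          simpa [α] using h3
        exact (sub_eq_zero.1 ((smul_eq_zero.1 h4).resolve_right hv)).symm
      rw [Units.val_mul, mul_pow, Units.val_mk0, h2, mul_one]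
    exact hτ (IsAlgebraic.of_pow Nat.card_pos (h1 ▸ h.pow _))
  have hfin := L.finrank_quotient_add_finrank
  have hL1 : Module.finrank k L = 1 := finrank_span_singleton hv
  have hQ := ih (Module.finrank k (V ⧸ L)) (by omega) (ρ.quotient L hL) rfl
  have hLr : FoxRigid r j fun w (u : L) => (FreeGroup.lift (fun _ => τ * α) w : k) • u :=
    (FoxRigid.of_transcendental r j hr (τ * α) htrans).of_injective
      (LinearEquiv.toSpanNonzeroSingleton k V v hv).symm.toAddMonoidHom
      (LinearEquiv.toSpanNonzeroSingleton k V v hv).symm.injective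
      fun w u => (map_smul (LinearEquiv.toSpanNonzeroSingleton k V v hv).symm _ u)
  refine FoxRigid.of_quotient L hLr hQ ?_ ?_
  · intro w u
    rw [hLact, smul_smul, ← Units.val_mul, ← MonoidHom.mul_apply]
    have : FreeGroup.lift (fun _ => τ * α) =
      FreeGroup.lift (fun _ : Fin (m + 1) => τ) * FreeGroup.lift (fun _ => α) := by
      ext; simp
    rw [this]
    rfl
  · intro w u
    rfl

end PGroupRepresentations

/-! ### Commutator subgroups of groups of order less than 24. -/

section SmallGroups

/-- If some prime `p` has a Sylow subgroup of index `r` with `|G| ∤ r!`, then `G` has a nontrivial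
normal subgroup contained in a proper one. -/
lemma exists_normal_of_not_dvd_factorial {G : Type*} [Group G] [Finite G] (p : ℕ) [Fact p.Prime]
    (h : ¬ Nat.card G ∣
      (Nat.card G / p ^ (Nat.card G).factorization p).factorial) (hp : ¬ IsPGroup p G) :
    ∃ N : Subgroup G, N.Normal ∧ N ≠ ⊥ ∧ N ≠ ⊤ := by
  obtain ⟨H⟩ : Nonempty (Sylow p G) := inferInstance
  have hH := H.card_eq_multiplicity
  have hidx : (H : Subgroup G).index = Nat.card G / p ^ (Nat.card G).factorization p := by
    rw [← hH]
    exact (Nat.div_eq_of_eq_mul_right Nat.card_pos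
      (H : Subgroup G).card_mul_index.symm).symm
  -- G modulo the core embeds in the permutations of the cosets of `H`.
  have hdvd : (H : Subgroup G).normalCore.index ∣ (H : Subgroup G).index.factorial := by
    rw [Subgroup.normalCore_eq_ker, Subgroup.index_ker, Subgroup.index_eq_card, ← Nat.card_perm]
    exact Subgroup.card_subgroup_dvd_card (MulAction.toPermHom G (G ⧸ (H : Subgroup G))).range
  refine ⟨(H : Subgroup G).normalCore, inferInstance, fun hb => h ?_, fun ht => hp ?_⟩
  · rwa [hb, Subgroup.index_bot, hidx] at hdvd
  · have : (H : Subgroup G) = ⊤ := top_le_iff.1 (ht ▸ (H : Subgroup G).normalCore_le)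
    have hP := H.isPGroup'
    rw [this] at hP
    exact hP.of_equiv Subgroup.topEquiv

lemma subsingleton_of_perfect_of_isPGroup {G : Type*} [Group G] [Finite G] (p : ℕ) [Fact p.Prime]
    (h : IsPGroup p G) (hG : commutator G = ⊤) : Subsingleton G := by
  have := h.isNilpotent
  by_contra hn
  rw [not_subsingleton_iff_nontrivial] at hn
  exact (Group.IsSolvable.commutator_lt_top_of_nontrivial G).ne hG

/-- There is no nontrivial perfect group of order less than `24`. -/
lemma subsingleton_of_perfect_of_card_lt {G : Type*} [Group G] [Finite G]
    (hG : commutator G = ⊤) (hn : Nat.card G < 24) : Subsingleton G := by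
  induction hm : Nat.card G using Nat.strong_induction_on generalizing G with
  | _ n ih =>
  subst hm
  have key : ∀ p : ℕ, p.Prime → (IsPGroup p G ∨ ¬ Nat.card G ∣
      (Nat.card G / p ^ (Nat.card G).factorization p).factorial) → Subsingleton G := by
    intro p hp h
    have := Fact.mk hp
    by_cases hP : IsPGroup p G
    · exact subsingleton_of_perfect_of_isPGroup p hP hG
    obtain ⟨N, hN, hbot, htop⟩ := exists_normal_of_not_dvd_factorial p (h.resolve_left hP) hP
    -- The quotient is again perfect and is smaller, hence trivial by induction, although `N` is
    -- proper.
    have hc : commutator (G ⧸ N) = ⊤ := by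
      rw [commutator_def, ← Subgroup.map_top_of_surjective _ (QuotientGroup.mk'_surjective N),
        ← Subgroup.map_commutator, ← commutator_def, hG]
    have hlt : Nat.card (G ⧸ N) < Nat.card G := by
      rw [← Subgroup.index_eq_card, ← N.card_mul_index]
      exact lt_mul_of_one_lt_left (Nat.pos_of_ne_zero N.index_ne_zero_of_finite)
        (N.one_lt_card_iff_ne_bot.2 hbot)
    have := ih _ hlt hc (hlt.trans hn) rfl
    exact absurd (QuotientGroup.subsingleton_iff.1 this) htop
  have hpow : ∀ p k : ℕ, p.Prime → Nat.card G = p ^ k → Subsingleton G := fun p k hp h =>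
    key p hp (Or.inl (have := Fact.mk hp; IsPGroup.of_card h))
  have hfac : ∀ p e r : ℕ, p.Prime → Nat.card G = p ^ e * r → ¬ p ∣ r →
      ¬ p ^ e * r ∣ r.factorial → Subsingleton G := by
    intro p e r hp h hr hd
    refine key p hp (Or.inr ?_)
    have hr0 : r ≠ 0 := by rintro rfl; simp at hr
    have : (Nat.card G).factorization p = e := by
      rw [h, Nat.factorization_mul (pow_ne_zero _ hp.ne_zero) hr0, Finsupp.add_apply,
        hp.factorization_pow, Finsupp.single_eq_same, Nat.factorization_eq_zero_of_not_dvd hr,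
        add_zero]
    rw [this, h, Nat.mul_div_cancel_left _ (pow_pos hp.pos _)]
    exact hd
  have hpos : 0 < Nat.card G := Nat.card_pos
  generalize Nat.card G = n at *
  -- For orders p^e r that are not prime powers, p is chosen so that p^e r does not divide r!; for
  -- 12 this requires p = 2.
  interval_cases n
  · exact hpow 2 0 (by norm_num) rfl
  · exact hpow 2 1 (by norm_num) rfl
  · exact hpow 3 1 (by norm_num) rfl
  · exact hpow 2 2 (by norm_num) rfl
  · exact hpow 5 1 (by norm_num) rfl
  · exact hfac 3 1 2 (by norm_num) rfl (by norm_num) (by decide)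
  · exact hpow 7 1 (by norm_num) rfl
  · exact hpow 2 3 (by norm_num) rfl
  · exact hpow 3 2 (by norm_num) rfl
  · exact hfac 5 1 2 (by norm_num) rfl (by norm_num) (by decide)
  · exact hpow 11 1 (by norm_num) rfl
  · exact hfac 2 2 3 (by norm_num) rfl (by norm_num) (by decide)
  · exact hpow 13 1 (by norm_num) rfl
  · exact hfac 7 1 2 (by norm_num) rfl (by norm_num) (by decide)
  · exact hfac 5 1 3 (by norm_num) rfl (by norm_num) (by decide)
  · exact hpow 2 4 (by norm_num) rfl
  · exact hpow 17 1 (by norm_num) rfl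
  · exact hfac 3 2 2 (by norm_num) rfl (by norm_num) (by decide)
  · exact hpow 19 1 (by norm_num) rfl
  · exact hfac 5 1 4 (by norm_num) rfl (by norm_num) (by decide)
  · exact hfac 7 1 3 (by norm_num) rfl (by norm_num) (by decide)
  · exact hfac 11 1 2 (by norm_num) rfl (by norm_num) (by decide)
  · exact hpow 23 1 (by norm_num) rfl

/-- If the abelianization of `G` is cyclic, a normal subgroup of `G` has not index `2` in the
commutator subgroup. -/
lemma relIndex_commutator_ne_two {G : Type*} [Group G] [IsCyclic (Abelianization G)]
    (N : Subgroup G) [hN : N.Normal] (hle : N ≤ commutator G) :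
    N.relIndex (commutator G) ≠ 2 := by
  intro h2
  -- Conjugation acts trivially on a quotient of order 2. Thus G/N is a central extension of a
  -- cyclic group, hence abelian, and `N` contains all commutators.
  have hmem : ∀ x ∈ commutator G, ∀ g : G, g * x * g⁻¹ * x⁻¹ ∈ N := by
    intro x hx g
    have hx' : g * x * g⁻¹ ∈ commutator G := Subgroup.Normal.conj_mem inferInstance x hx g
    have := Subgroup.mul_mem_iff_of_index_two (H := N.subgroupOf (commutator G)) h2
      (a := ⟨_, hx'⟩) (b := ⟨x, hx⟩⁻¹)
    simp only [Subgroup.mem_subgroupOf, inv_mem_iff] at this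
    exact this.2 (hN.mem_comm_iff.trans (by rw [inv_mul_cancel_left]))
  have hker : (QuotientGroup.lift N Abelianization.of (by rwa [Abelianization.ker_of])).ker ≤
      Subgroup.center (G ⧸ N) := by
    intro y
    induction y using QuotientGroup.induction_on with
    | _ x =>
    intro hx
    rw [MonoidHom.mem_ker, QuotientGroup.lift_mk, ← MonoidHom.mem_ker,
      Abelianization.ker_of] at hx
    rw [Subgroup.mem_center_iff]
    intro z
    induction z using QuotientGroup.induction_on with
    | _ g =>
    rw [← QuotientGroup.mk_mul, ← QuotientGroup.mk_mul, eq_comm, QuotientGroup.eq]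
    simpa [mul_assoc] using hmem x⁻¹ (inv_mem hx) g⁻¹
  have hcomm := (MonoidHom.isMulCommutative_of_isCyclic_of_ker_le_center _ hker).is_comm.comm
  have : commutator G ≤ N := by
    rw [commutator_def, Subgroup.commutator_le]
    intro g _ h _
    rw [← QuotientGroup.eq_one_iff, commutatorElement_def]
    exact mul_inv_eq_one.2 ((mul_inv_eq_iff_eq_mul).2 (hcomm g h))
  rw [Subgroup.relIndex_eq_one.2 this] at h2
  omega

/-- A finite group of order less than `24` with cyclic abelianization has a commutator subgroup
of prime power order. -/
lemma exists_isPGroup_commutator {G : Type*} [Group G] [Finite G] [IsCyclic (Abelianization G)]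
    (hn : Nat.card G < 24) : ∃ p : ℕ, p.Prime ∧ IsPGroup p (commutator G) := by
  have hpow : ∀ p k : ℕ, p.Prime → Nat.card (commutator G) = p ^ k →
      ∃ p : ℕ, p.Prime ∧ IsPGroup p (commutator G) := fun p k hp h =>
    ⟨p, hp, IsPGroup.of_card h⟩
  by_cases htop : commutator G = ⊤
  · have := subsingleton_of_perfect_of_card_lt htop hn
    exact hpow 2 0 Nat.prime_two Nat.card_unique
  have hcard := (commutator G).card_mul_index
  have hidx1 : (commutator G).index ≠ 1 := mt Subgroup.index_eq_one.1 htop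
  have hidx0 : (commutator G).index ≠ 0 := Subgroup.index_ne_zero_of_finite
  have hlt : Nat.card (commutator G) < 12 := by
    by_contra! h
    have := Nat.mul_le_mul h (show 2 ≤ (commutator G).index by omega)
    omega
  -- The Sylow q-subgroup has index 2, so it is normal, hence characteristic, in the commutator
  -- subgroup, and therefore normal in `G`.
  have htwo : ∀ q : ℕ, q.Prime → q ≠ 2 → Nat.card (commutator G) = q * 2 → False := by
    intro q hq hq2 h
    have := Fact.mk hq
    obtain ⟨H⟩ : Nonempty (Sylow q (commutator G)) := inferInstance
    have hH : Nat.card (H : Subgroup (commutator G)) = q := by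
      rw [H.card_eq_multiplicity, h, Nat.factorization_mul hq.ne_zero two_ne_zero,
        Finsupp.add_apply, hq.factorization_self, Nat.factorization_eq_zero_of_not_dvd
          (fun hd => hq2 ((Nat.prime_dvd_prime_iff_eq hq Nat.prime_two).1 hd)), add_zero, pow_one]
    have hi : (H : Subgroup (commutator G)).index = 2 := by
      have := (H : Subgroup (commutator G)).card_mul_index
      rw [hH, h] at this
      exact Nat.eq_of_mul_eq_mul_left hq.pos this
    have hnor : (H : Subgroup (commutator G)).Normal := Subgroup.normal_of_index_eq_two hi
    have hchar : (H : Subgroup (commutator G)).Characteristic := H.characteristic_of_normal hnor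
    have hle : (H : Subgroup (commutator G)).map (commutator G).subtype ≤ commutator G :=
      Subgroup.map_subtype_le _
    refine relIndex_commutator_ne_two _ hle ?_
    rwa [Subgroup.relIndex, Subgroup.subgroupOf, Subgroup.comap_map_eq_self_of_injective
      (commutator G).subtype_injective]
  have hpos : 0 < Nat.card (commutator G) := Nat.card_pos
  generalize Nat.card (commutator G) = d at *
  interval_cases d
  · exact hpow 2 0 (by norm_num) rfl
  · exact hpow 2 1 (by norm_num) rfl
  · exact hpow 3 1 (by norm_num) rfl
  · exact hpow 2 2 (by norm_num) rfl
  · exact hpow 5 1 (by norm_num) rfl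
  · exact (htwo 3 (by norm_num) (by norm_num) rfl).elim
  · exact hpow 7 1 (by norm_num) rfl
  · exact hpow 2 3 (by norm_num) rfl
  · exact hpow 3 2 (by norm_num) rfl
  · exact (htwo 5 (by norm_num) (by norm_num) rfl).elim
  · exact hpow 11 1 (by norm_num) rfl

end SmallGroups

/-! ### Nonvanishing of twisted Alexander polynomials. -/

section Vanishing

namespace WirtingerPresentation

variable {Γ : Type*} [Group Γ] {μ : Γ} (P : WirtingerPresentation Γ μ)

lemma isConj_gen (i j : Fin (P.m + 1)) : IsConj (P.gen i) (P.gen j) :=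
  (P.gen_meridian i).symm.trans (P.gen_meridian j)

/-- The generators are conjugate, so a homomorphism to an abelian group which kills one of them is
trivial. -/
lemma foxRigid_trivial {V : Type*} [AddCommGroup V] (j : Fin (P.m + 1)) :
    FoxRigid P.rel j fun _ (v : V) => v := by
  intro d hd hr hj w
  let D : FreeGroup (Fin (P.m + 1)) →* Multiplicative V :=
    MonoidHom.mk' (fun w => Multiplicative.ofAdd (d w)) fun u v => by rw [hd, ofAdd_add]
  have hker : (FreeGroup.lift P.gen).ker ≤ D.ker := by
    rw [P.ker_eq]
    refine Subgroup.normalClosure_le_normal ?_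
    rintro _ ⟨a, rfl⟩
    exact hr a
  have hD : D = 1 := by
    refine FreeGroup.ext_hom _ _ fun i => ?_
    obtain ⟨c, hc⟩ := isConj_iff.1 (P.isConj_gen j i)
    obtain ⟨u, rfl⟩ := P.surjective c
    -- Conjugacy holds only in `Γ`, so it is used through the kernel, which `D` kills.
    have h1 : u * FreeGroup.of j * u⁻¹ * (FreeGroup.of i)⁻¹ ∈ (FreeGroup.lift P.gen).ker := by
      rw [MonoidHom.mem_ker]
      simp [hc]
    have h2 := MonoidHom.mem_ker.1 (hker h1)
    have hj' : D (FreeGroup.of j) = 1 := hj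
    simpa [hj'] using h2
  exact DFunLike.congr_fun hD w

lemma toAdd_apply_gen {φ : Γ →* Multiplicative ℤ} (hμ : φ μ = Multiplicative.ofAdd 1)
    (i : Fin (P.m + 1)) : φ (P.gen i) = Multiplicative.ofAdd 1 := by
  rw [← hμ, eq_comm, ← isConj_iff_eq]
  exact φ.map_isConj (P.gen_meridian i)

lemma isCyclic_abelianization (P : WirtingerPresentation Γ μ) {G : Type*} [Group G] (f : Γ →* G) (hf : Function.Surjective f) :
    IsCyclic (Abelianization G) := by
  refine ⟨Abelianization.of (f μ), fun x => ?_⟩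
  obtain ⟨g, rfl⟩ := QuotientGroup.mk_surjective x
  obtain ⟨s, rfl⟩ := hf g
  obtain ⟨w, rfl⟩ := P.surjective s
  change (Abelianization.of.comp (f.comp (FreeGroup.lift P.gen))) w ∈
    Subgroup.zpowers (Abelianization.of (f μ))
  induction w with
  | C1 => rw [map_one]; exact one_mem _
  | of i =>
    have h : Abelianization.of (f μ) = Abelianization.of (f (P.gen i)) :=
      isConj_iff_eq.1 ((Abelianization.of.comp f).map_isConj (P.gen_meridian i))
    rw [h, MonoidHom.comp_apply, MonoidHom.comp_apply, FreeGroup.lift_apply_of]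
    exact Subgroup.mem_zpowers _
  | inv_of i hi => rw [map_inv]; exact inv_mem hi
  | mul u v hu hv => rw [map_mul]; exact mul_mem hu hv

end WirtingerPresentation

/-- The regular representation on functions, by right translation. -/
def rightTranslation (k G : Type*) [CommRing k] [Group G] : Representation k G (G → k) where
  toFun g := LinearMap.funLeft k k (· * g)
  map_one' := by ext; simp [LinearMap.funLeft]
  map_mul' g h := by ext; simp [LinearMap.funLeft, mul_assoc]

/-- Substituting τ for t allows the numerator to be tested in characteristic p and the denominator
over ℚ. -/
lemma eval₂_tensorHom_mulVec {Γ G k : Type*} [Group Γ] [Group G] [Fintype G] [DecidableEq G]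
    [CommRing k] (φ : Γ →* Multiplicative ℤ) (f : Γ →* G) (τ : kˣ) (s : Γ) (v : G → k) :
    ((LaurentPolynomial.eval₂ (Int.castRingHom k) τ).mapMatrix
      (tensorHom φ ((regularRep G).comp f) s)).mulVec v =
      ((τ ^ (Multiplicative.toAdd (φ s)) : kˣ) : k) • rightTranslation k G (f s) v := by
  ext x
  simp [tensorHom, regularRep, rightTranslation, Matrix.mulVec, dotProduct,
    LinearMap.funLeft, LaurentPolynomial.eval₂_T, apply_ite]

variable {Γ : Type*} [Group Γ] {μ : Γ}

/-- At t = 2 a kernel vector v would satisfy 2ρ(g)v = v, and iterating |G| times gives 2^|G| v = v.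
-/
lemma det_Phi_sub_one_ne_zero (P : WirtingerPresentation Γ μ) {G : Type*} [Group G] [Fintype G]
    [DecidableEq G] {φ : Γ →* Multiplicative ℤ} (hμ : φ μ = Multiplicative.ofAdd 1) (f : Γ →* G)
    (j : Fin (P.m + 1)) :
    (P.Phi φ ((regularRep G).comp f)
      (MonoidAlgebra.of ℤ _ (FreeGroup.of j) - 1)).det ≠ 0 := by
  intro h0
  let τ : ℚˣ := Units.mk0 2 two_ne_zero
  let e := LaurentPolynomial.eval₂ (Int.castRingHom ℚ) τ
  have h1 : (e.mapMatrix (tensorHom φ ((regularRep G).comp f) (P.gen j)) - 1).det = 0 := by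
    rw [← map_zero e, ← h0, RingHom.map_det]
    congr 1
    have h2 : P.Phi φ ((regularRep G).comp f) (MonoidAlgebra.of ℤ _ (FreeGroup.of j) - 1) =
        tensorHom φ ((regularRep G).comp f) (P.gen j) - 1 := by
      simp [WirtingerPresentation.Phi]
    rw [h2, map_sub, map_one]
  obtain ⟨v, hv, hv1⟩ := Matrix.exists_mulVec_eq_zero_iff.2 h1
  rw [Matrix.sub_mulVec, Matrix.one_mulVec, sub_eq_zero, eval₂_tensorHom_mulVec,
    P.toAdd_apply_gen hμ, toAdd_ofAdd, zpow_one] at hv1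
  have h2 : ∀ n : ℕ, (2 : ℚ) ^ n • rightTranslation ℚ G (f (P.gen j) ^ n) v = v := by
    intro n
    induction n with
    | zero => simp
    | succ n ih =>
      rw [pow_succ, pow_succ, map_mul, Module.End.mul_apply, mul_smul, ← map_smul]
      exact (congrArg _ (congrArg _ hv1)).trans ih
  have h3 := h2 (Nat.card G)
  rw [pow_card_eq_one', map_one, Module.End.one_apply] at h3
  have h4 : ((2 : ℚ) ^ Nat.card G - 1) • v = 0 := by rw [sub_smul, h3, one_smul, sub_self]
  have h5 : (1 : ℚ) < 2 ^ Nat.card G := one_lt_pow₀ one_lt_two Nat.card_pos.ne'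
  exact (smul_eq_zero.1 h4).elim (fun h => by linarith) hv

/-- If the commutator subgroup of `G` is a `p`-group, then the numerator of the twisted Alexander
polynomial of the regular representation does not vanish. -/
lemma det_foxMatrix_ne_zero_of_isPGroup_commutator (P : WirtingerPresentation Γ μ) {G : Type*}
    [Group G] [Fintype G] [DecidableEq G] {p : ℕ} [Fact p.Prime] (hG : IsPGroup p (commutator G))
    {φ : Γ →* Multiplicative ℤ} (hμ : φ μ = Multiplicative.ofAdd 1) (f : Γ →* G)
    (hf : Function.Surjective f) (j : Fin (P.m + 1)) :
    (P.foxMatrix φ ((regularRep G).comp f) j).det ≠ 0 := by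
  -- This field supplies both the eigenvalues and a transcendental value X for t.
  let k := AlgebraicClosure (RatFunc (ZMod p))
  let τ : kˣ := Units.mk0 (algebraMap (RatFunc (ZMod p)) k RatFunc.X)
    ((map_ne_zero _).2 RatFunc.X_ne_zero)
  have hτ : Transcendental (ZMod p) (τ : k) :=
    (transcendental_algebraMap_iff (algebraMap (RatFunc (ZMod p)) k).injective).2
      RatFunc.transcendental_X
  let e := LaurentPolynomial.eval₂ (Int.castRingHom k) τ
  have hrigid := (P.foxRigid_trivial (V := ZMod p) j).of_isPGroup_commutator hG
    (f.comp (FreeGroup.lift P.gen)) (hf.comp P.surjective)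
    (fun i => by simpa using f.map_isConj (P.isConj_gen j i)) τ hτ (rightTranslation k G)
  change (foxBlockMatrix P.rel j
    ((tensorHom φ ((regularRep G).comp f)).comp (FreeGroup.lift P.gen))).det ≠ 0
  intro h0
  have h1 := det_foxBlockMatrix_map P.rel j
    ((tensorHom φ ((regularRep G).comp f)).comp (FreeGroup.lift P.gen)) e
  rw [h0, map_zero] at h1
  refine (det_foxBlockMatrix_ne_zero_iff P.rel j _).2 ?_ h1.symm
  convert hrigid using 3 with w v
  have hφ : (zpowersHom kˣ τ).comp (φ.comp (FreeGroup.lift P.gen)) =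
      FreeGroup.lift fun _ => τ := by
    ext i
    simp [P.toAdd_apply_gen hμ]
  rw [← hφ]
  exact eval₂_tensorHom_mulVec φ f τ _ v

/-- Only the Wirtinger presentation matters here; the topology of the knot does not enter. -/
theorem le_card_of_isTwistedAlexanderPolynomial_zero {G : Type*} [Group G] [Fintype G]
    [DecidableEq G] (f : Γ →* G) (hf : Function.Surjective f)
    (h : IsTwistedAlexanderPolynomial μ ((regularRep G).comp f) 0) : 24 ≤ Nat.card G := by
  obtain ⟨φ, P, j, ε, l, -, hμ, h0⟩ := h
  by_contra! hlt
  have := P.isCyclic_abelianization f hf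
  obtain ⟨p, hp, hG⟩ := exists_isPGroup_commutator hlt
  have := Fact.mk hp
  have hinj := IsFractionRing.injective (LaurentPolynomial ℤ) (FractionRing (LaurentPolynomial ℤ))
  have hunit : (LaurentPolynomial.C (ε : ℤ) * LaurentPolynomial.T l) ≠ 0 :=
    ((ε.isUnit.map LaurentPolynomial.C).mul (LaurentPolynomial.isUnit_T l)).ne_zero
  refine mul_ne_zero ?_ (div_ne_zero ?_ ?_) h0.symm
  · exact (map_ne_zero_iff _ hinj).2 hunit
  · exact (map_ne_zero_iff _ hinj).2
      (det_foxMatrix_ne_zero_of_isPGroup_commutator P hG hμ f hf j)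
  · exact (map_ne_zero_iff _ hinj).2 (det_Phi_sub_one_ne_zero P hμ f j)

lemma OrientedKnot.IsTAVGroup.le_card {K : OrientedKnot} {G : Type*} [Group G] [Finite G]
    (h : K.IsTAVGroup G) : 24 ≤ Nat.card G := by
  obtain ⟨N, f, hf, h⟩ := h
  let _ := Fintype.ofFinite G
  classical exact le_card_of_isTwistedAlexanderPolynomial_zero f hf h

end Vanishing

end

theorem mainTheorem8 :
    (∀ K : OrientedKnot, 24 ≤ K.tavOrder) ∧
    ∀ (G : Type*) [Group G] [Finite G], IsTAVGroup G → 24 ≤ Nat.card G := by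
  refine ⟨fun K => ?_, fun G _ _ ⟨K, hK⟩ => hK.le_card⟩
  unfold OrientedKnot.tavOrder
  split_ifs
  · exact le_top
  -- If there is no TAV group the infimum in `ℕ∞` is `⊤`, which this bound also covers.
  · refine le_sInf ?_
    rintro _ ⟨G, _, _, hG, rfl⟩
    exact_mod_cast hG.le_card
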